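/- Let $M$ be a (finite-dimensional, smooth, Hausdorff) manifold, $h$ a Riemannian metric on $M$, and $\nabla,\nabla^*$ two affine connections on $M$ such that $(h,\nabla,\nabla^*)$ is a dually flat structure, that is, $$X\big(h(Y,Z)\big)=h(\nabla_XY,Z)+h(Y,\nabla^*_XZ)$$ for all vector fields $X,Y,Z$ on $M$, and the torsion and the curvature tensor of both $\nabla$ and $\nabla^*$ vanish. Let $\pi:TM\to M$ be the projection, let $K:T(TM)\to TM$ be the connector of $\nabla$ (the fibrewise linear map with $K(Y_*X)=\nabla_XY$ for all vector fields $X,Y$; in the coordinates $(a,b,c,d)$ of $T(TM)$ induced by coordinates on $M$, $K(a,b,c,d)=(a,d+\Gamma_a(b,c))$), and let $g$ be the Riemannian metric on $TM$ given by Dombrowski's construction, $$g_u(A,B)=h_{\pi(u)}(\pi_*A,\pi_*B)+h_{\pi(u)}(KA,KB),\qquad u\in TM,\ A,B\in T_u(TM).$$ Let $d$ and $\rho$ be the Riemannian distances of $h$ on $M$ and of $g$ on $TM$ (infimum of the lengths of curves joining two points, $+\infty$ if there is none). Then $$(TM,\rho)\ \text{is complete}\iff (M,d)\ \text{is complete}.$$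 -/

import Mathlib

open Bundle Manifold VectorField Filter Topology
open scoped Manifold ContDiff ENNReal

noncomputable section

namespace DuallyFlat

variable {E : Type*} [NormedAddCommGroup E] [NormedSpace ℝ E]
  {H : Type*} [TopologicalSpace H] {I : ModelWithCorners ℝ E H}
  {M : Type*} [TopologicalSpace M] [ChartedSpace H M]

/-! ### Completeness for the Riemannian distance -/

/-- The (extended) Riemannian distance of a Riemannian metric `g` on `M`: the infimum of the
`g`-lengths of `C^1` paths between two points (it is `∞` if there is no such path, that is, if the
points lie in different components). It is packaged as a pseudo-emetric structure, whose uniformity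
is the one of this distance. -/
@[reducible] def riemannianDistance (g : RiemannianMetric (fun x : M ↦ TangentSpace I x)) :
    PseudoEMetricSpace M :=
  letI : RiemannianBundle (fun x : M ↦ TangentSpace I x) := ⟨g⟩
  { edist := riemannianEDist I
    edist_self := fun _ ↦ riemannianEDist_self
    edist_comm := fun _ _ ↦ riemannianEDist_comm
    edist_triangle := fun _ _ _ ↦ riemannianEDist_triangle }

/-- `M` is complete for the Riemannian distance of `g`. -/
def IsCompleteFor (g : RiemannianMetric (fun x : M ↦ TangentSpace I x)) : Prop :=
  @CompleteSpace M (riemannianDistance g).toUniformSpace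

variable [IsManifold I ∞ M]

/-! ### Dually flat structures -/

/-- `X` is a smooth vector field on `M`. -/
def IsSmoothField (X : Π x : M, TangentSpace I x) : Prop :=
  ContMDiff I I.tangent ∞ (fun x ↦ (⟨x, X x⟩ : TangentBundle I M))

/-- The curvature `R(X, Y)Z = ∇_X ∇_Y Z - ∇_Y ∇_X Z - ∇_{[X, Y]} Z`
(`cov Y p v` is `∇_v Y` at the point `p`). -/
def curvature
    (cov : CovariantDerivative I E (TangentSpace I : M → Type _))
    (X Y Z : Π x : M, TangentSpace I x) (p : M) : TangentSpace I p :=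
  cov (fun q ↦ cov Z q (Y q)) p (X p) - cov (fun q ↦ cov Z q (X q)) p (Y p)
    - cov Z p (mlieBracket I X Y p)

/-- A connection is flat if its torsion and its curvature tensor vanish. -/
structure IsFlat [FiniteDimensional ℝ E]
    (cov : CovariantDerivative I E (TangentSpace I : M → Type _)) : Prop where
  torsion : haveI : CompleteSpace E := FiniteDimensional.complete ℝ E
    cov.torsion = 0
  curvature : ∀ X Y Z : Π x : M, TangentSpace I x,
    IsSmoothField X → IsSmoothField Y → IsSmoothField Z → ∀ p, curvature cov X Y Z p = 0

/-- `(h, ∇, ∇*)` is a dualistic structure: `∇` and `∇*` are smooth connections on the tangent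
bundle and `X (h(Y, Z)) = h(∇_X Y, Z) + h(Y, ∇*_X Z)`. -/
structure IsDualistic
    (h : ContMDiffRiemannianMetric I ∞ E (fun x : M ↦ TangentSpace I x))
    (cov covStar : CovariantDerivative I E (TangentSpace I : M → Type _)) : Prop where
  smooth : cov.ContMDiffCovariantDerivative ∞
  smooth_star : covStar.ContMDiffCovariantDerivative ∞
  dual : ∀ X Y Z : Π x : M, TangentSpace I x,
    IsSmoothField X → IsSmoothField Y → IsSmoothField Z → ∀ p : M,
      mvfderiv I (fun q ↦ h.inner q (Y q) (Z q)) p (X p)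
        = h.inner p (cov Y p (X p)) (Z p) + h.inner p (Y p) (covStar Z p (X p))

/-- `(h, ∇, ∇*)` is a dually flat structure. -/
structure IsDuallyFlat [FiniteDimensional ℝ E]
    (h : ContMDiffRiemannianMetric I ∞ E (fun x : M ↦ TangentSpace I x))
    (cov covStar : CovariantDerivative I E (TangentSpace I : M → Type _)) : Prop where
  dualistic : IsDualistic h cov covStar
  flat : IsFlat cov
  flat_star : IsFlat covStar

/-! ### The connector and the metric on the tangent bundle -/

/-- The derivative `π_*` at `u` of the projection `π : TM → M`. -/
def projDeriv (u : TangentBundle I M) :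
    TangentSpace I.tangent u →L[ℝ] TangentSpace I u.proj :=
  mfderiv I.tangent I (TotalSpace.proj : TangentBundle I M → M) u

/-- The fibre coordinates on `TM` near the fibre over `p`, read in the preferred chart at `p`
(they are the differentials of the coordinates of that chart). -/
def fibreCoord (p : M) (w : TangentBundle I M) : E :=
  (trivializationAt E (TangentSpace I) p w).2

/-- The connector `K : T(TM) → TM` of a connection. In the coordinates `(a, b, c, d)` of `T(TM)`
given by a chart of `M`, it is `K(a, b, c, d) = (a, d + Γ_a(b, c))`: here `d` is the derivative of
the fibre coordinates, `c = π_* A`, and `Γ_a(b, c)` is the covariant derivative in the direction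
`c` of the local field with constant coordinates `b`, which is `FiberBundle.extend`. It satisfies
`K (Y_* X) = ∇_X Y` for all vector fields, see `connector_mfderiv`. -/
def connector (cov : CovariantDerivative I E (TangentSpace I : M → Type _))
    (u : TangentBundle I M) : TangentSpace I.tangent u →L[ℝ] TangentSpace I u.proj :=
  (trivializationAt E (TangentSpace I) u.proj).symmL ℝ u.proj
      ∘L mvfderiv I.tangent (fibreCoord (I := I) u.proj) u
    + cov (FiberBundle.extend E u.snd) u.proj ∘L projDeriv u

lemma mdifferentiableAt_fibreCoord (u : TangentBundle I M) :
    MDifferentiableAt I.tangent 𝓘(ℝ, E) (fibreCoord (I := I) u.proj) u := by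
  have h := (mdifferentiableAt_totalSpace I (F := E) (E := (TangentSpace I : M → Type _))
    (IM := I.tangent) (fun w : TangentBundle I M ↦ w) (x₀ := u)).1 mdifferentiableAt_id
  exact h.2

lemma mdifferentiableAt_tangentProj (u : TangentBundle I M) :
    MDifferentiableAt I.tangent I (TotalSpace.proj : TangentBundle I M → M) u := by
  have h := (mdifferentiableAt_totalSpace I (F := E) (E := (TangentSpace I : M → Type _))
    (IM := I.tangent) (fun w : TangentBundle I M ↦ w) (x₀ := u)).1 mdifferentiableAt_id
  exact h.1

lemma mvfderiv_fibreCoord_comp (Y : Π x : M, TangentSpace I x) (p : M)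
    (hY : MDifferentiableAt I I.tangent (fun x ↦ (⟨x, Y x⟩ : TangentBundle I M)) p)
    (v : TangentSpace I p) :
    mvfderiv I.tangent (fibreCoord (I := I) p) (⟨p, Y p⟩ : TangentBundle I M)
        (mfderiv I I.tangent (fun x ↦ (⟨x, Y x⟩ : TangentBundle I M)) p v)
      = mvfderiv I (fun x ↦ fibreCoord p (⟨x, Y x⟩ : TangentBundle I M)) p v := by
  have h := mfderiv_comp p (I := I) (I' := I.tangent) (I'' := 𝓘(ℝ, E))
    (f := fun x ↦ (⟨x, Y x⟩ : TangentBundle I M)) (g := fibreCoord (I := I) p)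
    (mdifferentiableAt_fibreCoord (⟨p, Y p⟩ : TangentBundle I M)) hY
  exact congr($h v).symm

lemma projDeriv_mfderiv (Y : Π x : M, TangentSpace I x) (p : M)
    (hY : MDifferentiableAt I I.tangent (fun x ↦ (⟨x, Y x⟩ : TangentBundle I M)) p)
    (v : TangentSpace I p) :
    projDeriv (⟨p, Y p⟩ : TangentBundle I M)
        (mfderiv I I.tangent (fun x ↦ (⟨x, Y x⟩ : TangentBundle I M)) p v) = v := by
  have h := mfderiv_comp p (I := I) (I' := I.tangent) (I'' := I)
    (f := fun x ↦ (⟨x, Y x⟩ : TangentBundle I M))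
    (g := (TotalSpace.proj : TangentBundle I M → M))
    (mdifferentiableAt_tangentProj (⟨p, Y p⟩ : TangentBundle I M)) hY
  have h2 : mfderiv I I (fun x : M ↦ x) p v = v := by
    rw [show (fun x : M ↦ x) = id from rfl, mfderiv_id]; rfl
  have h3 : mfderiv I I (fun x : M ↦ x) p v = _ := congr($h v)
  exact h3.symm.trans h2

lemma eq_zero_of_projDeriv_of_fibreCoord (u : TangentBundle I M)
    (A : TangentSpace I.tangent u) (h₁ : projDeriv u A = 0)
    (h₂ : mvfderiv I.tangent (fibreCoord (I := I) u.proj) u A = 0) : A = 0 := by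
  have : IsManifold I.tangent 1 (TangentBundle I M) := inferInstance
  have hinv := isInvertible_mfderiv_extChartAt (I := I.tangent) (mem_extChartAt_source u)
  have hinj : Function.Injective (mfderiv I.tangent 𝓘(ℝ, E × E) (extChartAt I.tangent u) u) := by
    obtain ⟨e, he⟩ := hinv
    rw [← he]; exact e.injective
  apply hinj
  rw [map_zero]
  have hchart : MDifferentiableAt I 𝓘(ℝ, E) (extChartAt I u.proj) u.proj :=
    mdifferentiableAt_extChartAt (mem_chart_source H u.proj)
  have hfun : (extChartAt I.tangent u : TangentBundle I M → E × E)
      = fun w ↦ (extChartAt I u.proj w.proj, fibreCoord (I := I) u.proj w) := by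
    funext w
    rw [FiberBundle.extChartAt]
    rfl
  have hd : HasMFDerivAt I.tangent 𝓘(ℝ, E × E) (extChartAt I.tangent u) u
      (mfderiv I.tangent 𝓘(ℝ, E × E) (extChartAt I.tangent u) u) :=
    (mdifferentiableAt_extChartAt (mem_chart_source _ u)).hasMFDerivAt
  have d1 := ((ContinuousLinearMap.fst ℝ E E).hasMFDerivAt (x := extChartAt I.tangent u u)).comp u hd
  have d2 := ((ContinuousLinearMap.snd ℝ E E).hasMFDerivAt (x := extChartAt I.tangent u u)).comp u hd
  have f1 : (ContinuousLinearMap.fst ℝ E E ∘ extChartAt I.tangent u : TangentBundle I M → E)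
      = extChartAt I u.proj ∘ TotalSpace.proj := by
    rw [hfun]; rfl
  have f2 : (ContinuousLinearMap.snd ℝ E E ∘ extChartAt I.tangent u : TangentBundle I M → E)
      = fibreCoord (I := I) u.proj := by
    rw [hfun]; rfl
  rw [f1] at d1
  rw [f2] at d2
  have h4 : mfderiv I.tangent 𝓘(ℝ, E) (extChartAt I u.proj ∘ TotalSpace.proj) u A = 0 := by
    rw [mfderiv_comp u hchart (mdifferentiableAt_tangentProj u)]
    exact (congrArg (mfderiv I 𝓘(ℝ, E) (extChartAt I u.proj) u.proj) h₁).trans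
      (map_zero (mfderiv I 𝓘(ℝ, E) (extChartAt I u.proj) u.proj))
  have k1 := congr($(d1.mfderiv) A).symm.trans h4
  have k2 := congr($(d2.mfderiv) A).symm.trans h₂
  exact Prod.ext k1 k2

lemma cov_sum_smul (cov : CovariantDerivative I E (TangentSpace I : M → Type _))
    {ι : Type*} (s : Finset ι) (f : ι → M → ℝ) (σ : ι → Π x : M, TangentSpace I x) (p : M)
    (hf : ∀ i, MDifferentiableAt I 𝓘(ℝ, ℝ) (f i) p)
    (hσ : ∀ i, MDifferentiableAt I I.tangent (fun x ↦ (⟨x, σ i x⟩ : TangentBundle I M)) p) :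
    MDifferentiableAt I I.tangent
        (fun x ↦ (⟨x, (∑ i ∈ s, f i • σ i) x⟩ : TangentBundle I M)) p ∧
      cov (∑ i ∈ s, f i • σ i) p
        = ∑ i ∈ s, (f i p • cov (σ i) p + (mvfderiv I (f i) p).smulRight (σ i p)) := by
  classical
  induction s using Finset.induction_on with
  | empty => exact ⟨by simpa using! mdifferentiableAt_zeroSection .., by simp⟩
  | insert i s hi ih =>
    have h1 := (hf i).smul_section (hσ i)
    rw [Finset.sum_insert hi, Finset.sum_insert hi]
    refine ⟨mdifferentiableAt_add_section h1 ih.1, ?_⟩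
    rw [cov.isCovariantDerivativeOn.add (s := Set.univ) h1 ih.1,
      cov.isCovariantDerivativeOn.leibniz (s := Set.univ) (hσ i) (hf i), ih.2]

/-- The defining property of the connector: `K (Y_* X) = ∇_X Y`. -/
theorem connector_mfderiv [FiniteDimensional ℝ E]
    (cov : CovariantDerivative I E (TangentSpace I : M → Type _))
    (Y : Π x : M, TangentSpace I x) (p : M)
    (hY : MDifferentiableAt I I.tangent (fun x ↦ (⟨x, Y x⟩ : TangentBundle I M)) p)
    (v : TangentSpace I p) :
    connector cov (⟨p, Y p⟩ : TangentBundle I M)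
        (mfderiv I I.tangent (fun x ↦ (⟨x, Y x⟩ : TangentBundle I M)) p v) = cov Y p v := by
  set t := trivializationAt E (TangentSpace I : M → Type _) p with ht
  have hp : p ∈ t.baseSet := FiberBundle.mem_baseSet_trivializationAt' p
  let b := Module.finBasis ℝ E
  let w : Fin (Module.finrank ℝ E) → TangentSpace I p := fun i ↦ t.symm p (b i)
  let σ : Fin (Module.finrank ℝ E) → Π x : M, TangentSpace I x := fun i ↦ FiberBundle.extend E (w i)
  have hσ : ∀ i, MDifferentiableAt I I.tangent
      (fun x ↦ (⟨x, σ i x⟩ : TangentBundle I M)) p :=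
    fun i ↦ FiberBundle.mdifferentiableAt_extend I E (w i)
  have hσ' : ∀ i x, σ i x = t.symm x (b i) := by
    intro i x
    simp only [σ, FiberBundle.extend, w, ← ht]
    rw [t.apply_mk_symm hp]
  let c : Fin (Module.finrank ℝ E) → E →L[ℝ] ℝ := fun i ↦ (b.coord i).toContinuousLinearMap
  have hc : ∀ e : E, ∑ i, c i e • b i = e := fun e ↦ b.sum_repr e
  have hsum : ∀ x ∈ t.baseSet, ∀ e : E, ∑ i, c i e • σ i x = t.symm x e := by
    intro x hx e
    have := congrArg (t.symmL ℝ x) (hc e)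
    rw [map_sum] at this
    simp only [map_smul] at this
    simp only [hσ']
    simpa only [t.symmL_apply (R := ℝ) hx] using this
  let φ : M → E := fun x ↦ fibreCoord p (⟨x, Y x⟩ : TangentBundle I M)
  have hφ : MDifferentiableAt I 𝓘(ℝ, E) φ p :=
    MDifferentiableAt.comp p (f := fun x ↦ (⟨x, Y x⟩ : TangentBundle I M))
      (g := fibreCoord (I := I) p) (I' := I.tangent)
      (mdifferentiableAt_fibreCoord (⟨p, Y p⟩ : TangentBundle I M)) hY
  have hcφ : ∀ i, HasMFDerivAt I 𝓘(ℝ, ℝ) (fun x ↦ c i (φ x)) p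
      ((c i).comp (mvfderiv I φ p)) :=
    fun i ↦ (c i).hasMFDerivAt.comp p hφ.hasMFDerivAt
  have h1 := cov_sum_smul cov Finset.univ (fun i x ↦ c i (φ x)) σ p
    (fun i ↦ (hcφ i).mdifferentiableAt) hσ
  have h2 := cov_sum_smul cov Finset.univ (fun i _ ↦ c i (φ p)) σ p
    (fun i ↦ mdifferentiableAt_const) hσ
  have hnhds := t.open_baseSet.mem_nhds hp
  have e1 : cov Y p = _ := cov.isCovariantDerivativeOnUniv.congr_of_eventuallyEq hY h1.1 univ_mem (by
    filter_upwards [hnhds] with x hx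
    simp only [Finset.sum_apply, Pi.smul_apply']
    rw [hsum x hx]
    exact (t.symm_apply_apply_mk hx (Y x)).symm)
  have e2 : cov (FiberBundle.extend E (Y p)) p = _ :=
    cov.isCovariantDerivativeOnUniv.congr_of_eventuallyEq
      (FiberBundle.mdifferentiableAt_extend I E (Y p)) h2.1 univ_mem (by
    filter_upwards [hnhds] with x hx
    simp only [Finset.sum_apply, Pi.smul_apply']
    rw [hsum x hx]
    rfl)
  have hK : connector cov (⟨p, Y p⟩ : TangentBundle I M)
        (mfderiv I I.tangent (fun x ↦ (⟨x, Y x⟩ : TangentBundle I M)) p v)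
      = t.symm p (mvfderiv I φ p v) + cov (FiberBundle.extend E (Y p)) p v := by
    have a1 := mvfderiv_fibreCoord_comp Y p hY v
    have a2 := projDeriv_mfderiv Y p hY v
    simp only [connector, _root_.add_apply, ContinuousLinearMap.comp_apply]
    rw [a1, a2, Trivialization.symmL_apply (R := ℝ) _ hp]
  rw [hK, e1, e2, h1.2, h2.2, ← hsum p hp]
  simp only [mvfderiv_const, _root_.sum_apply, _root_.add_apply,
    ContinuousLinearMap.smulRight_apply, Finset.sum_add_distrib, _root_.zero_apply,
    zero_smul, Finset.sum_const_zero, add_zero]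
  rw [add_comm]
  congr 1
  refine Finset.sum_congr rfl fun i _ ↦ ?_
  congr 1
  have := (hcφ i).mfderiv
  exact congr($this v).symm

/-- `g_u(A, B) = h(π_* A, π_* B) + h(K A, K B)`, as a bilinear form on `T_u(TM)`. -/
def dombrowskiInner (h : ContMDiffRiemannianMetric I ∞ E (fun x : M ↦ TangentSpace I x))
    (cov : CovariantDerivative I E (TangentSpace I : M → Type _)) (u : TangentBundle I M) :
    TangentSpace I.tangent u →L[ℝ] TangentSpace I.tangent u →L[ℝ] ℝ :=
  (projDeriv u).precomp ℝ ∘L h.inner u.proj ∘L projDeriv u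
    + (connector cov u).precomp ℝ ∘L h.inner u.proj ∘L connector cov u

lemma dombrowskiInner_apply
    (h : ContMDiffRiemannianMetric I ∞ E (fun x : M ↦ TangentSpace I x))
    (cov : CovariantDerivative I E (TangentSpace I : M → Type _)) (u : TangentBundle I M)
    (A B : TangentSpace I.tangent u) :
    dombrowskiInner h cov u A B
      = h.inner u.proj (projDeriv u A) (projDeriv u B)
        + h.inner u.proj (connector cov u A) (connector cov u B) := rfl

lemma inner_self_nonneg (h : ContMDiffRiemannianMetric I ∞ E (fun x : M ↦ TangentSpace I x))
    (p : M) (v : TangentSpace I p) : 0 ≤ h.inner p v v := by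
  rcases eq_or_ne v 0 with rfl | hv
  · simp
  · exact (h.pos p v hv).le

/-- The horizontal and the vertical component determine a tangent vector of `TM`. -/
lemma eq_zero_of_projDeriv_of_connector
    (cov : CovariantDerivative I E (TangentSpace I : M → Type _)) (u : TangentBundle I M)
    (A : TangentSpace I.tangent u) (h₁ : projDeriv u A = 0) (h₂ : connector cov u A = 0) :
    A = 0 := by
  refine eq_zero_of_projDeriv_of_fibreCoord u A h₁ ?_
  have hp := FiberBundle.mem_baseSet_trivializationAt' (F := E) (E := (TangentSpace I : M → Type _))
    u.proj
  have h3 : (trivializationAt E (TangentSpace I) u.proj).symmL ℝ u.proj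
      (mvfderiv I.tangent (fibreCoord (I := I) u.proj) u A) = 0 := by
    have := h₂
    simp only [connector, _root_.add_apply, ContinuousLinearMap.comp_apply, h₁, map_zero,
      add_zero] at this
    exact this
  have h4 := congrArg ((trivializationAt E (TangentSpace I) u.proj).continuousLinearMapAt ℝ u.proj)
    h3
  rw [Trivialization.continuousLinearMapAt_symmL (R := ℝ) _ hp, map_zero] at h4
  exact h4

/-- The Riemannian metric on `TM` associated to `(h, ∇)` by Dombrowski's construction:
`g_u(A, B) = h(π_* A, π_* B) + h(K A, K B)`. -/
def dombrowskiMetric [FiniteDimensional ℝ E]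
    (h : ContMDiffRiemannianMetric I ∞ E (fun x : M ↦ TangentSpace I x))
    (cov : CovariantDerivative I E (TangentSpace I : M → Type _)) :
    RiemannianMetric (fun u : TangentBundle I M ↦ TangentSpace I.tangent u) where
  inner := dombrowskiInner h cov
  symm u A B := by
    simp only [dombrowskiInner_apply, h.symm u.proj (projDeriv u A),
      h.symm u.proj (connector cov u A)]
  pos u A hA := by
    rw [dombrowskiInner_apply]
    by_cases h₁ : projDeriv u A = 0
    · have h₂ : connector cov u A ≠ 0 := fun h₂ ↦
        hA (eq_zero_of_projDeriv_of_connector cov u A h₁ h₂)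
      exact add_pos_of_nonneg_of_pos (inner_self_nonneg h _ _) (h.pos _ _ h₂)
    · exact add_pos_of_pos_of_nonneg (h.pos _ _ h₁) (inner_self_nonneg h _ _)
  continuousAt u := by
    let B : E × E →L[ℝ] E × E →L[ℝ] ℝ := dombrowskiInner h cov u
    have : Continuous fun A : E × E ↦ B A A := by fun_prop
    exact this.continuousAt
  isVonNBounded u := by
    let L : E × E →L[ℝ] E × E := (projDeriv u).prod (connector cov u)
    have hL : Function.Injective L := by
      refine (injective_iff_map_eq_zero L).2 fun A hA ↦ ?_
      exact eq_zero_of_projDeriv_of_connector cov u A (congrArg Prod.fst hA)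
        (congrArg Prod.snd hA)
    obtain ⟨R, hR⟩ := L.toLinearMap.exists_leftInverse_of_injective (LinearMap.ker_eq_bot.2 hL)
    have hb : Bornology.IsVonNBounded ℝ {v : E | h.inner u.proj v v < 1} :=
      h.isVonNBounded u.proj
    have hb1 := (NormedSpace.isVonNBounded_iff ℝ).1 hb
    have hb2 := ((NormedSpace.isVonNBounded_iff ℝ).2 (hb1.prod hb1)).image R.toContinuousLinearMap
    refine hb2.subset fun A hA ↦ ?_
    have hA' : h.inner u.proj (projDeriv u A) (projDeriv u A)
        + h.inner u.proj (connector cov u A) (connector cov u A) < 1 := hA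
    have n1 := inner_self_nonneg h u.proj (projDeriv u A)
    have n2 := inner_self_nonneg h u.proj (connector cov u A)
    refine ⟨L A, ⟨?_, ?_⟩, congr($hR A)⟩
    · change h.inner u.proj (projDeriv u A) (projDeriv u A) < 1
      linarith
    · change h.inner u.proj (connector cov u A) (connector cov u A) < 1
      linarith

end DuallyFlat

end

/-! The projection `π` does not increase distances, because `g` dominates the pullback of `h`
(`rdist_proj_le`). The zero section does not either, because its covariant derivative vanishes
(`rdist_zeroSection_le`). A Cauchy sequence of `M` therefore lifts to `TM` along the zero section,
and the limit projects back.

For the converse, the base points of a Cauchy sequence in `TM` converge to some `p`, and the danger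
is that the vectors escape to infinity in the fibres. In a chart at `p`, with fibre coordinates `b`
and their derivative `d` along `A`, the connector gives `d = K A - Γ(b, π_* A)`, hence `‖d‖ ≤ C (1 +
‖b‖) ‖A‖`. So `log (1 + |b|²)`, with a Euclidean `|·|`, is Lipschitz over a small ball
(`eventually_abs_mvfderiv_logGrowth_le`, `abs_logGrowth_sub_le`) and `b` stays bounded. A
subsequence of the coordinates converges to some `y`. Moving to the fibre over `p` with constant
coordinates (`rdist_constSection_le`), then straight inside that fibre (`rdist_fibre_le`), shows
convergence in `TM`. -/

noncomputable section

namespace DuallyFlat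

open MeasureTheory Set

/-! ### Lengths, Riemannian distances and completeness by sequences -/

section Metric

variable {E : Type*} [NormedAddCommGroup E] [NormedSpace ℝ E]
  {H : Type*} [TopologicalSpace H] {I : ModelWithCorners ℝ E H}
  {M : Type*} [TopologicalSpace M] [ChartedSpace H M]

/-- The length of a tangent vector for a Riemannian metric. -/
def vnorm (g : RiemannianMetric (fun x : M ↦ TangentSpace I x)) (x : M)
    (v : TangentSpace I x) : ℝ :=
  √(g.inner x v v)

/-- The Riemannian distance of `g` between two points. -/
def rdist (g : RiemannianMetric (fun x : M ↦ TangentSpace I x)) (x y : M) : ℝ≥0∞ :=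
  (riemannianDistance g).edist x y

/-- The `g`-length of a path parametrized by `[0, 1]`. -/
def pathLength (g : RiemannianMetric (fun x : M ↦ TangentSpace I x)) (γ : ℝ → M) : ℝ≥0∞ :=
  ∫⁻ t in Icc (0 : ℝ) 1, ENNReal.ofReal (vnorm g (γ t) (mfderiv 𝓘(ℝ, ℝ) I γ t (1 : ℝ)))

variable (g : RiemannianMetric (fun x : M ↦ TangentSpace I x))

lemma vnorm_eq_norm (x : M) (v : TangentSpace I x) :
    letI : RiemannianBundle (fun x : M ↦ TangentSpace I x) := ⟨g⟩
    vnorm g x v = ‖v‖ := by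
  let : RiemannianBundle (fun x : M ↦ TangentSpace I x) := ⟨g⟩
  exact (norm_eq_sqrt_real_inner v).symm

lemma vnorm_nonneg (x : M) (v : TangentSpace I x) : 0 ≤ vnorm g x v := Real.sqrt_nonneg _

lemma vnorm_zero (x : M) : vnorm g x 0 = 0 := by
  simp [vnorm]

lemma vnorm_sub_le (x : M) (v w : TangentSpace I x) :
    vnorm g x (v - w) ≤ vnorm g x v + vnorm g x w := by
  let : RiemannianBundle (fun x : M ↦ TangentSpace I x) := ⟨g⟩
  simpa only [vnorm_eq_norm g] using norm_sub_le v w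

lemma vnorm_smul (x : M) (a : ℝ) (v : TangentSpace I x) :
    vnorm g x (a • v) = |a| * vnorm g x v := by
  let : RiemannianBundle (fun x : M ↦ TangentSpace I x) := ⟨g⟩
  simpa only [vnorm_eq_norm g, Real.norm_eq_abs] using norm_smul a v

lemma vnorm_sum_le {ι : Type*} (s : Finset ι) (x : M) (v : ι → TangentSpace I x) :
    vnorm g x (∑ i ∈ s, v i) ≤ ∑ i ∈ s, vnorm g x (v i) := by
  let : RiemannianBundle (fun x : M ↦ TangentSpace I x) := ⟨g⟩
  simpa only [vnorm_eq_norm g] using norm_sum_le s v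

lemma rdist_eq (x y : M) :
    letI : RiemannianBundle (fun x : M ↦ TangentSpace I x) := ⟨g⟩
    rdist g x y = riemannianEDist I x y := rfl

lemma rdist_comm (x y : M) : rdist g x y = rdist g y x := (riemannianDistance g).edist_comm x y

lemma rdist_triangle (x y z : M) : rdist g x z ≤ rdist g x y + rdist g y z :=
  (riemannianDistance g).edist_triangle x y z

lemma pathELength_eq (γ : ℝ → M) (a b : ℝ) :
    letI : RiemannianBundle (fun x : M ↦ TangentSpace I x) := ⟨g⟩
    pathELength I γ a b = ∫⁻ t in Icc a b,
      ENNReal.ofReal (vnorm g (γ t) (mfderiv 𝓘(ℝ, ℝ) I γ t (1 : ℝ))) := by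
  let : RiemannianBundle (fun x : M ↦ TangentSpace I x) := ⟨g⟩
  simp only [pathELength_eq_lintegral_mfderiv_Icc]
  refine lintegral_congr fun t ↦ ?_
  rw [vnorm_eq_norm g, ofReal_norm]
  rfl

/-- Near-optimal paths can be made constant near their endpoints; such a path is `C^1` on all of
`ℝ`, so no one-sided derivatives arise later. -/
lemma exists_path_of_rdist_lt {x y : M} {r : ℝ≥0∞} (h : rdist g x y < r) :
    ∃ γ : ℝ → M, γ 0 = x ∧ γ 1 = y ∧ ContMDiff 𝓘(ℝ, ℝ) I 1 γ ∧ pathLength g γ < r := by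
  let : RiemannianBundle (fun x : M ↦ TangentSpace I x) := ⟨g⟩
  obtain ⟨γ, h0, h1, hγ, hl, -⟩ := exists_lt_locally_constant_of_riemannianEDist_lt
    (I := I) h zero_lt_one
  exact ⟨γ, h0, h1, hγ, by rwa [pathLength, ← pathELength_eq g]⟩

lemma rdist_le_setLIntegral {γ : ℝ → M} {a b : ℝ} (hab : a ≤ b)
    (hγ : ContMDiffOn 𝓘(ℝ, ℝ) I 1 γ (Icc a b)) :
    rdist g (γ a) (γ b) ≤ ∫⁻ t in Icc a b,
      ENNReal.ofReal (vnorm g (γ t) (mfderiv 𝓘(ℝ, ℝ) I γ t (1 : ℝ))) := by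
  let : RiemannianBundle (fun x : M ↦ TangentSpace I x) := ⟨g⟩
  rw [← pathELength_eq g, rdist_eq]
  exact riemannianEDist_le_pathELength hγ rfl rfl hab

lemma rdist_le_pathLength {γ : ℝ → M} (hγ : ContMDiff 𝓘(ℝ, ℝ) I 1 γ) {t : ℝ}
    (ht : t ∈ Icc (0 : ℝ) 1) : rdist g (γ 0) (γ t) ≤ pathLength g γ :=
  (rdist_le_setLIntegral g ht.1 hγ.contMDiffOn).trans
    (lintegral_mono_set (Icc_subset_Icc le_rfl ht.2))

/-- The uniformity of an extended distance is countably generated, so sequences suffice. Convergence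
is expressed by the distance itself, without reference to the given topology of `M`. -/
lemma isCompleteFor_iff :
    IsCompleteFor g ↔ ∀ u : ℕ → M,
      (∀ ε > 0, ∃ N, ∀ m ≥ N, ∀ n ≥ N, rdist g (u m) (u n) < ε) →
        ∃ x, Tendsto (fun n ↦ rdist g (u n) x) atTop (𝓝 0) := by
  let := riemannianDistance g
  constructor
  · intro hc u hu
    have : @CompleteSpace M (riemannianDistance g).toUniformSpace := hc
    have hu' : @CauchySeq M ℕ (riemannianDistance g).toUniformSpace _ u :=
      EMetric.cauchySeq_iff.2 hu
    obtain ⟨x, hx⟩ := @cauchySeq_tendsto_of_complete M ℕ (riemannianDistance g).toUniformSpace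
      _ _ u hu'
    exact ⟨x, tendsto_iff_edist_tendsto_0.1 hx⟩
  · intro h
    refine @EMetric.complete_of_cauchySeq_tendsto M (riemannianDistance g) fun u hu ↦ ?_
    obtain ⟨x, hx⟩ := h u (EMetric.cauchySeq_iff.1 hu)
    exact ⟨x, tendsto_iff_edist_tendsto_0.2 hx⟩

lemma tendsto_rdist_of_subseq {u : ℕ → M}
    (hu : ∀ ε > 0, ∃ N, ∀ m ≥ N, ∀ n ≥ N, rdist g (u m) (u n) < ε) {k : ℕ → ℕ}
    (hk : Tendsto k atTop atTop) {x : M}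
    (hx : Tendsto (fun n ↦ rdist g (u (k n)) x) atTop (𝓝 0)) :
    Tendsto (fun n ↦ rdist g (u n) x) atTop (𝓝 0) := by
  rw [ENNReal.tendsto_nhds_zero] at hx ⊢
  intro ε hε
  obtain ⟨N, hN⟩ := hu (ε / 2) (ENNReal.half_pos hε.ne')
  obtain ⟨m, hm₁, hm₂⟩ := ((hk.eventually_ge_atTop N).and
    (hx (ε / 2) (ENNReal.half_pos hε.ne'))).exists
  filter_upwards [eventually_ge_atTop N] with n hn
  calc _ ≤ rdist g (u n) (u (k m)) + rdist g (u (k m)) x := rdist_triangle _ _ _ _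
    _ ≤ ε / 2 + ε / 2 := add_le_add (hN n hn _ hm₁).le hm₂
    _ = ε := ENNReal.add_halves ε

/-! ### Maps with bounded derivative -/

section Maps

variable {E' : Type*} [NormedAddCommGroup E'] [NormedSpace ℝ E']
  {H' : Type*} [TopologicalSpace H'] {I' : ModelWithCorners ℝ E' H'}
  {M' : Type*} [TopologicalSpace M'] [ChartedSpace H' M']
  (g' : RiemannianMetric (fun x : M' ↦ TangentSpace I' x))

/-- Integrate the chain rule along `γ`. Hypotheses are imposed only at points of the path, so that
`f` may be a section that is smooth only locally. -/
lemma rdist_map_le_pathLength {f : M → M'} {γ : ℝ → M} {C : ℝ} (hC : 0 ≤ C)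
    (hγ : ContMDiff 𝓘(ℝ, ℝ) I 1 γ)
    (hf : ∀ t ∈ Icc (0 : ℝ) 1, ContMDiffAt I I' 1 f (γ t))
    (hle : ∀ t ∈ Icc (0 : ℝ) 1, ∀ v : TangentSpace I (γ t),
      vnorm g' (f (γ t)) (mfderiv I I' f (γ t) v) ≤ C * vnorm g (γ t) v) :
    rdist g' (f (γ 0)) (f (γ 1)) ≤ ENNReal.ofReal C * pathLength g γ := by
  have h1 : ContMDiffOn 𝓘(ℝ, ℝ) I' 1 (f ∘ γ) (Icc 0 1) := fun t ht ↦
    ((hf t ht).comp t hγ.contMDiffAt).contMDiffWithinAt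
  refine (rdist_le_setLIntegral g' zero_le_one h1).trans ?_
  rw [pathLength, ← lintegral_const_mul' _ _ ENNReal.ofReal_ne_top]
  refine setLIntegral_mono' measurableSet_Icc fun t ht ↦ ?_
  rw [← ENNReal.ofReal_mul hC]
  refine ENNReal.ofReal_le_ofReal ?_
  have hd : mfderiv 𝓘(ℝ, ℝ) I' (f ∘ γ) t (1 : ℝ)
      = mfderiv I I' f (γ t) (mfderiv 𝓘(ℝ, ℝ) I γ t (1 : ℝ)) := by
    rw [mfderiv_comp t ((hf t ht).mdifferentiableAt one_ne_zero)
      (hγ.mdifferentiable one_ne_zero t)]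
    rfl
  rw [hd]
  exact hle t ht _

lemma rdist_map_le {f : M → M'} (hf : ContMDiff I I' 1 f)
    (hle : ∀ x, ∀ v : TangentSpace I x, vnorm g' (f x) (mfderiv I I' f x v) ≤ vnorm g x v)
    (x y : M) : rdist g' (f x) (f y) ≤ rdist g x y := by
  refine le_of_forall_gt fun r hr ↦ ?_
  obtain ⟨γ, rfl, rfl, hγ, hl⟩ := exists_path_of_rdist_lt g hr
  refine (rdist_map_le_pathLength g g' zero_le_one hγ (fun t _ ↦ hf.contMDiffAt) ?_).trans_lt ?_
  · intro t _ v
    rw [one_mul]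
    exact hle _ v
  · simpa using hl

/-- The scalar counterpart, by the fundamental theorem of calculus for `φ ∘ γ`; it will bound the
logarithm of the fibre norm. -/
lemma ofReal_abs_sub_le_pathLength {φ : M → ℝ} {γ : ℝ → M} {C : ℝ} (hC : 0 ≤ C)
    (hγ : ContMDiff 𝓘(ℝ, ℝ) I 1 γ)
    (hφ : ∀ t ∈ Icc (0 : ℝ) 1, ContMDiffAt I 𝓘(ℝ, ℝ) 1 φ (γ t))
    (hle : ∀ t ∈ Icc (0 : ℝ) 1, ∀ v : TangentSpace I (γ t),
      |mvfderiv I φ (γ t) v| ≤ C * vnorm g (γ t) v) :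
    ENNReal.ofReal |φ (γ 1) - φ (γ 0)| ≤ ENNReal.ofReal C * pathLength g γ := by
  have h1 : ContDiffOn ℝ 1 (φ ∘ γ) (Icc 0 1) := contMDiffOn_iff_contDiffOn.1 fun t ht ↦
    ((hφ t ht).comp t hγ.contMDiffAt).contMDiffWithinAt
  have h2 := enorm_sub_le_lintegral_deriv_of_contDiffOn_Icc h1 zero_le_one
  rw [← Real.norm_eq_abs, ofReal_norm]
  refine h2.trans ?_
  rw [pathLength, ← lintegral_const_mul' _ _ ENNReal.ofReal_ne_top]
  refine setLIntegral_mono' measurableSet_Icc fun t ht ↦ ?_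
  rw [← ENNReal.ofReal_mul hC, ← ofReal_norm, Real.norm_eq_abs]
  refine ENNReal.ofReal_le_ofReal ?_
  have hd : deriv (φ ∘ γ) t = mvfderiv I φ (γ t) (mfderiv 𝓘(ℝ, ℝ) I γ t (1 : ℝ)) := by
    have := mfderiv_comp t ((hφ t ht).mdifferentiableAt one_ne_zero)
      (hγ.mdifferentiable one_ne_zero t)
    rw [mfderiv_eq_fderiv] at this
    rw [← fderiv_apply_one_eq_deriv]
    exact congr($this (1 : ℝ))
  rw [hd]
  exact hle t ht _

end Maps

end Metric

/-! ### Local fields with constant components -/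

section Connection

variable {E : Type*} [NormedAddCommGroup E] [NormedSpace ℝ E]
  {H : Type*} [TopologicalSpace H] {I : ModelWithCorners ℝ E H}
  {M : Type*} [TopologicalSpace M] [ChartedSpace H M] [IsManifold I ∞ M]

variable (I) in
/-- The set over which the preferred trivialization of the tangent bundle at `p` is defined. -/
def baseSetAt (p : M) : Set M := (trivializationAt E (TangentSpace I : M → Type _) p).baseSet

variable (I) in
lemma isOpen_baseSetAt (p : M) : IsOpen (baseSetAt I p) :=
  (trivializationAt E (TangentSpace I : M → Type _) p).open_baseSet

variable (I) in
lemma mem_baseSetAt (p : M) : p ∈ baseSetAt I p :=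
  FiberBundle.mem_baseSet_trivializationAt' p

variable (I) in
lemma baseSetAt_eq (p : M) : baseSetAt I p = (chartAt H p).source :=
  TangentBundle.trivializationAt_baseSet p

/-- The local vector field whose components in the preferred chart at `p` are constant. -/
def constSection (p : M) (e : E) (x : M) : TangentSpace I x :=
  (trivializationAt E (TangentSpace I : M → Type _) p).symmL ℝ x e

lemma fibreCoord_constSection {p x : M} (hx : x ∈ baseSetAt I p) (e : E) :
    fibreCoord p (⟨x, constSection p e x⟩ : TangentBundle I M) = e := by
  have := (trivializationAt E (TangentSpace I : M → Type _) p).continuousLinearMapAt_symmL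
    (R := ℝ) hx e
  rwa [Trivialization.continuousLinearMapAt_apply, Trivialization.coe_linearMapAt_of_mem _ hx]
    at this

lemma constSection_fibreCoord {p : M} {u : TangentBundle I M} (hu : u.proj ∈ baseSetAt I p) :
    constSection p (fibreCoord p u) u.proj = u.snd := by
  have := (trivializationAt E (TangentSpace I : M → Type _) p).symmL_continuousLinearMapAt
    (R := ℝ) hu u.snd
  rwa [Trivialization.continuousLinearMapAt_apply, Trivialization.coe_linearMapAt_of_mem _ hu]
    at this

lemma contMDiffAt_fibreCoord {p : M} {u : TangentBundle I M} (hu : u.proj ∈ baseSetAt I p) :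
    ContMDiffAt I.tangent 𝓘(ℝ, E) ∞ (fibreCoord (I := I) p) u := by
  have h := ((trivializationAt E (TangentSpace I : M → Type _) p).contMDiffAt_iff (IM := I.tangent)
    (IB := I) (n := ∞) (f := fun w : TangentBundle I M ↦ w) (x₀ := u)
    ((Trivialization.mem_source _).2 hu)).1 contMDiffAt_id
  exact h.2

lemma contMDiffAt_constSection {p x : M} (hx : x ∈ baseSetAt I p) (e : E) :
    ContMDiffAt I I.tangent ∞
      (fun x ↦ (⟨x, constSection p e x⟩ : TangentBundle I M)) x := by
  refine ((trivializationAt E (TangentSpace I : M → Type _) p).contMDiffAt_iff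
    (f := fun x ↦ (⟨x, constSection p e x⟩ : TangentBundle I M))
    ((Trivialization.mem_source _).2 hx)).2 ⟨contMDiffAt_id, ?_⟩
  refine (contMDiffAt_const (c := e)).congr_of_eventuallyEq ?_
  filter_upwards [(isOpen_baseSetAt I p).mem_nhds hx] with y hy
  exact fibreCoord_constSection hy e

lemma mdifferentiableAt_constSection {p x : M} (hx : x ∈ baseSetAt I p) (e : E) :
    MDifferentiableAt I I.tangent
      (fun x ↦ (⟨x, constSection p e x⟩ : TangentBundle I M)) x :=
  (contMDiffAt_constSection hx e).mdifferentiableAt (by simp)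

variable (cov : CovariantDerivative I E (TangentSpace I : M → Type _))

/-- The Leibniz terms vanish for constant coefficients. This reduces bounds uniform in `e` to
finitely many basis vectors. -/
lemma cov_constSection_eq_sum {ι : Type*} [Fintype ι] (b : Module.Basis ι ℝ E) {p x : M}
    (hx : x ∈ baseSetAt I p) (e : E) :
    cov (constSection p e) x = ∑ i, b.repr e i • cov (constSection p (b i)) x := by
  have h := (cov_sum_smul cov Finset.univ (fun i _ ↦ b.repr e i)
    (fun i ↦ constSection (I := I) p (b i)) x (fun i ↦ mdifferentiableAt_const)
    (fun i ↦ mdifferentiableAt_constSection hx (b i))).2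
  have hs : (∑ i, (fun _ : M ↦ b.repr e i) • constSection (I := I) p (b i))
      = constSection (I := I) p e := by
    funext y
    simp only [Finset.sum_apply, Pi.smul_apply', constSection]
    conv_rhs => rw [← b.sum_repr e, map_sum]
    simp only [map_smul]
  rw [hs] at h
  rw [h]
  refine Finset.sum_congr rfl fun i _ ↦ ?_
  rw [mvfderiv_const]
  ext v
  simp

/-- Smoothness of the connection is applied to a global smooth field, obtained by cutting off with a
bump function; locality of `cov` transfers the result back. -/
lemma contMDiffAt_cov_constSection [FiniteDimensional ℝ E] [T2Space M] (hcov : cov.ContMDiffCovariantDerivative ∞)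
    (p : M) (e : E) :
    ContMDiffAt I (I.prod 𝓘(ℝ, E →L[ℝ] E)) ∞
      (fun x ↦ (⟨x, cov (constSection p e) x⟩ :
        TotalSpace (E →L[ℝ] E) fun x : M ↦ TangentSpace I x →L[ℝ] TangentSpace I x)) p := by
  let f : SmoothBumpFunction I p := Classical.arbitrary _
  have h1 : ContMDiff I I.tangent ∞
      (fun x ↦ (⟨x, (⇑f • constSection (I := I) p e) x⟩ : TangentBundle I M)) := by
    refine ContMDiffOn.smul_section_of_tsupport (u := baseSetAt I p) f.contMDiff.contMDiffOn
      (isOpen_baseSetAt I p) ?_ fun x hx ↦ (contMDiffAt_constSection hx e).contMDiffWithinAt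
    rw [baseSetAt_eq]
    exact f.tsupport_subset_chartAt_source
  have h2 := hcov.contMDiff.contMDiff (σ := ⇑f • constSection (I := I) p e) (h1.contMDiffOn)
  refine ((h2 p (Set.mem_univ p)).contMDiffAt univ_mem).congr_of_eventuallyEq ?_
  -- The covariant derivative at `x` depends on the germ at `x`, so the bump function has to equal
  -- `1` near each such `x`, not only at it.
  filter_upwards [f.eventuallyEq_one.eventually_nhds,
    (isOpen_baseSetAt I p).mem_nhds (mem_baseSetAt I p)] with x hx hxb
  have : cov (constSection p e) x = cov (⇑f • constSection (I := I) p e) x := by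
    refine cov.isCovariantDerivativeOnUniv.congr_of_eventuallyEq
      (mdifferentiableAt_constSection hxb e) (h1.mdifferentiable (by simp) x) univ_mem ?_
    filter_upwards [hx] with y hy
    simp [Pi.smul_apply', hy]
  rw [this]

end Connection

/-! ### The connector in a fixed chart -/

section Connector

variable {E : Type*} [NormedAddCommGroup E] [NormedSpace ℝ E]
  {H : Type*} [TopologicalSpace H] {I : ModelWithCorners ℝ E H}
  {M : Type*} [TopologicalSpace M] [ChartedSpace H M] [IsManifold I ∞ M]
  (cov : CovariantDerivative I E (TangentSpace I : M → Type _))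

/-- Write the `q`-coordinates as `T(π w)` applied to the `p`-coordinates. In the product rule the
derivative of `T` is evaluated at `π_* W = 0`. -/
lemma mvfderiv_fibreCoord_of_vertical {p q : M} {u : TangentBundle I M}
    (hp : u.proj ∈ baseSetAt I p) (hq : u.proj ∈ baseSetAt I q)
    (W : TangentSpace I.tangent u) (hW : projDeriv u W = 0) :
    mvfderiv I.tangent (fibreCoord (I := I) q) u W
      = (trivializationAt E (TangentSpace I : M → Type _) p).coordChangeL ℝ
          (trivializationAt E (TangentSpace I : M → Type _) q) u.proj
          (mvfderiv I.tangent (fibreCoord (I := I) p) u W) := by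
  set T : M → E →L[ℝ] E := fun x ↦
    ((trivializationAt E (TangentSpace I : M → Type _) p).coordChangeL ℝ
      (trivializationAt E (TangentSpace I : M → Type _) q) x : E →L[ℝ] E) with hT
  have hTd : MDifferentiableAt I 𝓘(ℝ, E →L[ℝ] E) T u.proj :=
    (contMDiffAt_coordChangeL (n := ∞) (IB := I) hp hq).mdifferentiableAt (by simp)
  have h1 : HasMFDerivAt I.tangent 𝓘(ℝ, E →L[ℝ] E) (T ∘ TotalSpace.proj) u _ :=
    hTd.hasMFDerivAt.comp u (mdifferentiableAt_tangentProj u).hasMFDerivAt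
  have h2 : HasMFDerivAt I.tangent 𝓘(ℝ, E) (fibreCoord (I := I) p) u _ :=
    ((contMDiffAt_fibreCoord hp).mdifferentiableAt (by simp)).hasMFDerivAt
  have h3 : HasMFDerivAt I.tangent 𝓘(ℝ, E) (fun w ↦ (T ∘ TotalSpace.proj) w (fibreCoord p w)) u _ :=
    ⟨h1.1.clm_apply h2.1, h1.2.clm_apply h2.2⟩
  have h4 := h3.congr_of_eventuallyEq (f₁ := fibreCoord (I := I) q) (by
    filter_upwards [(FiberBundle.continuous_proj E (TangentSpace I : M → Type _)).continuousAt
      ((isOpen_baseSetAt I p).inter (isOpen_baseSetAt I q) |>.mem_nhds ⟨hp, hq⟩)] with w hw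
    have hs := constSection_fibreCoord (I := I) hw.1
    simp only [Function.comp, hT]
    refine Eq.trans ?_ ((trivializationAt E (TangentSpace I : M → Type _) p).coordChangeL_apply
      (R := ℝ) _ hw _).symm
    rw [← Trivialization.symmL_apply (R := ℝ) _ hw.1]
    simp only [constSection] at hs
    rw [hs]
    rfl)
  have h5 : mvfderiv I.tangent (fibreCoord (I := I) q) u W = _ := congr($(h4.mfderiv) W)
  rw [h5]
  have hz : mvfderiv I T u.proj (projDeriv u W) = 0 := by rw [hW, map_zero]
  have hu : (extChartAt I.tangent u).symm (extChartAt I.tangent u u) = u := extChartAt_to_inv u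
  -- The product rule was taken in the chart at `u`, so `T` appears at the chart preimage of the
  -- coordinates of `u`.
  change T ((extChartAt I.tangent u).symm (extChartAt I.tangent u u)).proj
      (mvfderiv I.tangent (fibreCoord (I := I) p) u W)
    + mvfderiv I T u.proj (projDeriv u W) _ = _
  rw [hu, hz, _root_.zero_apply, add_zero]
  rfl

lemma connector_of_vertical {p : M} {u : TangentBundle I M} (hu : u.proj ∈ baseSetAt I p)
    (W : TangentSpace I.tangent u) (hW : projDeriv u W = 0) :
    connector cov u W
      = constSection p (mvfderiv I.tangent (fibreCoord (I := I) p) u W) u.proj := by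
  have hq := mem_baseSetAt I u.proj
  simp only [connector, _root_.add_apply, ContinuousLinearMap.comp_apply, hW, map_zero, add_zero]
  rw [mvfderiv_fibreCoord_of_vertical hu hq W hW]
  rw [Trivialization.coordChangeL_apply (R := ℝ) _ _ ⟨hu, hq⟩]
  rw [Trivialization.symmL_apply (R := ℝ) _ hq, Trivialization.symm_apply_apply_mk _ hq,
    constSection, Trivialization.symmL_apply (R := ℝ) _ hu]

/-- The connector in the coordinates of a fixed chart: `K(a, b, c, d) = (a, d + Γ_a(b, c))`. -/
lemma connector_eq [FiniteDimensional ℝ E] {p : M} {u : TangentBundle I M}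
    (hu : u.proj ∈ baseSetAt I p) (A : TangentSpace I.tangent u) :
    connector cov u A
      = constSection p (mvfderiv I.tangent (fibreCoord (I := I) p) u A) u.proj
        + cov (constSection p (fibreCoord p u)) u.proj (projDeriv u A) := by
  have hY := constSection_fibreCoord hu
  obtain ⟨q, w⟩ := u
  generalize he : fibreCoord p (⟨q, w⟩ : TangentBundle I M) = e at hY ⊢
  dsimp only at hY hu
  subst hY
  have hYd := mdifferentiableAt_constSection hu e
  -- `B` lifts `π_* A` along the constant-component field through `u`: its fibre derivative is zero
  -- and `K B` is the Christoffel term, while `A - B` is vertical.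
  set B := mfderiv I I.tangent (fun x ↦ (⟨x, constSection p e x⟩ : TangentBundle I M)) q
    (projDeriv (⟨q, constSection p e q⟩ : TangentBundle I M) A) with hB
  have hπ := projDeriv_mfderiv (constSection p e) q hYd
    (projDeriv (⟨q, constSection p e q⟩ : TangentBundle I M) A)
  have hK := connector_mfderiv cov (constSection p e) q hYd
    (projDeriv (⟨q, constSection p e q⟩ : TangentBundle I M) A)
  have hfc : mvfderiv I.tangent (fibreCoord (I := I) p) (⟨q, constSection p e q⟩) B = 0 := by
    have h1 := mfderiv_comp q (I := I) (I' := I.tangent) (I'' := 𝓘(ℝ, E))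
      (f := fun x ↦ (⟨x, constSection p e x⟩ : TangentBundle I M))
      (g := fibreCoord (I := I) p)
      ((contMDiffAt_fibreCoord (u := ⟨q, constSection p e q⟩) hu).mdifferentiableAt (by simp)) hYd
    refine congr($h1 (projDeriv (⟨q, constSection p e q⟩ : TangentBundle I M) A)).symm.trans ?_
    have h2 : (fibreCoord (I := I) p ∘ fun x ↦ (⟨x, constSection p e x⟩ : TangentBundle I M))
        =ᶠ[𝓝 q] fun _ ↦ e := by
      filter_upwards [(isOpen_baseSetAt I p).mem_nhds hu] with x hx
      exact fibreCoord_constSection hx e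
    have h3 := h2.mfderiv_eq (I := I) (I' := 𝓘(ℝ, E))
    rw [h3, mfderiv_const]
    rfl
  have hv := connector_of_vertical cov (p := p) (u := ⟨q, constSection p e q⟩) hu (A - B)
    (by rw [map_sub, hB, hπ, sub_self])
  rw [map_sub, map_sub, hfc, sub_zero, hB, hK] at hv
  exact sub_eq_iff_eq_add.1 hv

end Connector

/-! ### The logarithmic growth function -/

section LogGrowth

variable {E : Type*} [NormedAddCommGroup E] [NormedSpace ℝ E] [FiniteDimensional ℝ E]

variable (E) in
/-- A smooth proper function on `E` of logarithmic growth. -/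
def logGrowth (e : E) : ℝ := Real.log (1 + ‖toEuclidean e‖ ^ 2)

/-- The norm of `E` need not be smooth off the origin; the squared Euclidean norm is smooth
everywhere. -/
lemma contDiff_logGrowth : ContDiff ℝ ∞ (logGrowth E) := by
  refine ContDiff.log ?_ fun e ↦ by positivity
  exact contDiff_const.add (toEuclidean.contDiff.norm_sq ℝ)

lemma exists_norm_le_exp_logGrowth :
    ∃ K : ℝ, 0 ≤ K ∧ ∀ e : E, ‖e‖ ≤ K * Real.exp (logGrowth E e) := by
  let L := (toEuclidean : E ≃L[ℝ] _)
  refine ⟨‖(L.symm : EuclideanSpace ℝ (Fin (Module.finrank ℝ E)) →L[ℝ] E)‖, norm_nonneg _, fun e ↦ ?_⟩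
  have h1 : ‖e‖ ≤ ‖(L.symm : EuclideanSpace ℝ (Fin (Module.finrank ℝ E)) →L[ℝ] E)‖ * ‖L e‖ := by
    simpa using (L.symm : EuclideanSpace ℝ (Fin (Module.finrank ℝ E)) →L[ℝ] E).le_opNorm (L e)
  refine h1.trans (mul_le_mul_of_nonneg_left ?_ (norm_nonneg _))
  rw [logGrowth, Real.exp_log (by positivity)]
  nlinarith [sq_nonneg (‖L e‖ - 1)]

/-- The derivative decays like `1 / (1 + ‖e‖)`, exactly what compensates the linear growth in `b` of
the Christoffel term. -/
lemma exists_fderiv_logGrowth_le :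
    ∃ D : ℝ, 0 ≤ D ∧ ∀ e d : E, |fderiv ℝ (logGrowth E) e d| * (1 + ‖e‖) ≤ D * ‖d‖ := by
  let L := (toEuclidean : E ≃L[ℝ] _)
  set a := ‖(L.symm : EuclideanSpace ℝ (Fin (Module.finrank ℝ E)) →L[ℝ] E)‖
  set b := ‖(L : E →L[ℝ] EuclideanSpace ℝ (Fin (Module.finrank ℝ E)))‖
  have ha : 0 ≤ a := norm_nonneg _
  have hb : 0 ≤ b := norm_nonneg _
  -- One factor `2` comes from differentiating the square, the other from `s (1 + s) ≤ 2 (1 + s²)`;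
  -- `a` and `b` compare the two norms.
  refine ⟨4 * b * (1 + a), by positivity, fun e d ↦ ?_⟩
  have h1 : ‖e‖ ≤ a * ‖L e‖ := by simpa using (L.symm : EuclideanSpace ℝ (Fin (Module.finrank ℝ E)) →L[ℝ] E).le_opNorm (L e)
  have h2 : ‖L d‖ ≤ b * ‖d‖ := (L : E →L[ℝ] EuclideanSpace ℝ (Fin (Module.finrank ℝ E))).le_opNorm d
  have hpos : 0 < 1 + ‖L e‖ ^ 2 := by positivity
  have hd : HasFDerivAt (logGrowth E) _ e :=
    ((L.hasFDerivAt (x := e)).norm_sq.const_add 1).log hpos.ne'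
  have hval : fderiv ℝ (logGrowth E) e d = (1 + ‖L e‖ ^ 2)⁻¹ * (2 * inner ℝ (L e) (L d)) := by
    rw [hd.fderiv]
    simp
  have h3 : |fderiv ℝ (logGrowth E) e d| ≤ (1 + ‖L e‖ ^ 2)⁻¹ * (2 * (‖L e‖ * (b * ‖d‖))) := by
    rw [hval, abs_mul, abs_of_pos (inv_pos.2 hpos), abs_mul, abs_two]
    gcongr
    exact (abs_real_inner_le_norm _ _).trans (by gcongr)
  have h4 : 1 + ‖e‖ ≤ (1 + a) * (1 + ‖L e‖) := by nlinarith [norm_nonneg (L e)]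
  have h5 : ‖L e‖ * (1 + ‖L e‖) ≤ 2 * (1 + ‖L e‖ ^ 2) := by nlinarith [sq_nonneg (‖L e‖ - 1)]
  calc |fderiv ℝ (logGrowth E) e d| * (1 + ‖e‖)
      ≤ (1 + ‖L e‖ ^ 2)⁻¹ * (2 * (‖L e‖ * (b * ‖d‖))) * ((1 + a) * (1 + ‖L e‖)) := by gcongr
    _ = (1 + ‖L e‖ ^ 2)⁻¹ * (‖L e‖ * (1 + ‖L e‖)) * (2 * b * (1 + a) * ‖d‖) := by ring
    _ ≤ (1 + ‖L e‖ ^ 2)⁻¹ * (2 * (1 + ‖L e‖ ^ 2)) * (2 * b * (1 + a) * ‖d‖) := by gcongr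
    _ = 4 * b * (1 + a) * ‖d‖ := by field_simp; ring

end LogGrowth

/-! ### Local bounds near a point of the base -/

section Estimates

variable {E : Type*} [NormedAddCommGroup E] [NormedSpace ℝ E]
  {H : Type*} [TopologicalSpace H] {I : ModelWithCorners ℝ E H}
  {M : Type*} [TopologicalSpace M] [ChartedSpace H M] [IsManifold I ∞ M]
  (h : ContMDiffRiemannianMetric I ∞ E (fun x : M ↦ TangentSpace I x))
  (cov : CovariantDerivative I E (TangentSpace I : M → Type _))

/-- Continuity of `h` makes the trivialization at `p` and its inverse locally bounded; this is the
bound for the inverse. -/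
lemma eventually_vnorm_constSection_le (p : M) :
    ∃ C > 0, ∀ᶠ x in 𝓝 p, ∀ e : E,
      vnorm h.toRiemannianMetric x (constSection p e x) ≤ C * ‖e‖ := by
  let : RiemannianBundle (fun x : M ↦ TangentSpace I x) := ⟨h.toRiemannianMetric⟩
  have : IsContinuousRiemannianBundle E (fun x : M ↦ TangentSpace I x) :=
    ⟨h.inner, h.contMDiff.continuous, fun _ _ _ ↦ rfl⟩
  obtain ⟨C, hC, hev⟩ := eventually_norm_symmL_trivializationAt_lt E
    (fun x : M ↦ TangentSpace I x) p
  refine ⟨C, hC, hev.mono fun x hx e ↦ ?_⟩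
  rw [vnorm_eq_norm]
  exact ContinuousLinearMap.le_of_opNorm_le _ hx.le e

lemma eventually_norm_continuousLinearMapAt_le (p : M) :
    ∃ C > 0, ∀ᶠ x in 𝓝 p, ∀ v : TangentSpace I x,
      ‖(trivializationAt E (TangentSpace I : M → Type _) p).continuousLinearMapAt ℝ x v‖
        ≤ C * vnorm h.toRiemannianMetric x v := by
  let : RiemannianBundle (fun x : M ↦ TangentSpace I x) := ⟨h.toRiemannianMetric⟩
  have : IsContinuousRiemannianBundle E (fun x : M ↦ TangentSpace I x) :=
    ⟨h.inner, h.contMDiff.continuous, fun _ _ _ ↦ rfl⟩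
  obtain ⟨C, hC, hev⟩ := eventually_norm_trivializationAt_lt E
    (fun x : M ↦ TangentSpace I x) p
  refine ⟨C, hC, hev.mono fun x hx v ↦ ?_⟩
  rw [vnorm_eq_norm]
  exact ContinuousLinearMap.le_of_opNorm_le _ hx.le v

variable [FiniteDimensional ℝ E]

lemma vnorm_projDeriv_le (u : TangentBundle I M) (A : TangentSpace I.tangent u) :
    vnorm h.toRiemannianMetric u.proj (projDeriv u A) ≤ vnorm (dombrowskiMetric h cov) u A :=
  Real.sqrt_le_sqrt (le_add_of_nonneg_right (inner_self_nonneg h _ _))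

lemma vnorm_connector_le (u : TangentBundle I M) (A : TangentSpace I.tangent u) :
    vnorm h.toRiemannianMetric u.proj (connector cov u A) ≤ vnorm (dombrowskiMetric h cov) u A :=
  Real.sqrt_le_sqrt (le_add_of_nonneg_left (inner_self_nonneg h _ _))

lemma vnorm_dombrowskiMetric_le (u : TangentBundle I M) (A : TangentSpace I.tangent u) :
    vnorm (dombrowskiMetric h cov) u A ≤ vnorm h.toRiemannianMetric u.proj (projDeriv u A)
      + vnorm h.toRiemannianMetric u.proj (connector cov u A) := by
  refine Real.sqrt_le_iff.2 ⟨add_nonneg (vnorm_nonneg _ _ _) (vnorm_nonneg _ _ _), ?_⟩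
  have h1 := Real.sq_sqrt (inner_self_nonneg h u.proj (projDeriv u A))
  have h2 := Real.sq_sqrt (inner_self_nonneg h u.proj (connector cov u A))
  have h3 := vnorm_nonneg h.toRiemannianMetric u.proj (projDeriv u A)
  have h4 := vnorm_nonneg h.toRiemannianMetric u.proj (connector cov u A)
  change h.inner u.proj (projDeriv u A) (projDeriv u A)
    + h.inner u.proj (connector cov u A) (connector cov u A) ≤ _
  rw [← h1, ← h2]
  change vnorm h.toRiemannianMetric u.proj (projDeriv u A) ^ 2
    + vnorm h.toRiemannianMetric u.proj (connector cov u A) ^ 2 ≤ _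
  nlinarith

variable [T2Space M]

/-- For fixed `e` the covariant derivative is a continuous section of the endomorphism bundle near
`p`: its matrix is locally bounded by the value at `p` plus `1`. -/
lemma eventually_vnorm_cov_constSection_le_of_vector
    (hcov : cov.ContMDiffCovariantDerivative ∞) (p : M) (e : E) :
    ∃ C > 0, ∀ᶠ x in 𝓝 p, ∀ v : TangentSpace I x,
      vnorm h.toRiemannianMetric x (cov (constSection p e) x v)
        ≤ C * vnorm h.toRiemannianMetric x v := by
  obtain ⟨C₁, hC₁, h₁⟩ := eventually_vnorm_constSection_le h p
  obtain ⟨C₂, hC₂, h₂⟩ := eventually_norm_continuousLinearMapAt_le h p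
  have hs := ((contMDiffAt_hom_bundle _).1
    (contMDiffAt_cov_constSection cov hcov p e)).2.continuousAt.norm
  set φ : M → E →L[ℝ] E := fun x ↦ ContinuousLinearMap.inCoordinates E (TangentSpace I : M → Type _)
    E (TangentSpace I : M → Type _) p x p x (cov (constSection p e) x) with hφ
  have h₃ : ∀ᶠ x in 𝓝 p, ‖φ x‖ < ‖φ p‖ + 1 := hs.eventually_lt_const (by simp [hφ])
  refine ⟨C₁ * (‖φ p‖ + 1) * C₂, by positivity, ?_⟩
  filter_upwards [h₁, h₂, h₃, (isOpen_baseSetAt I p).mem_nhds (mem_baseSetAt I p)]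
    with x hx₁ hx₂ hx₃ hxb v
  set t := trivializationAt E (TangentSpace I : M → Type _) p
  have key : cov (constSection p e) x v
      = constSection p (φ x (t.continuousLinearMapAt ℝ x v)) x := by
    simp only [hφ, ContinuousLinearMap.inCoordinates, ContinuousLinearMap.comp_apply, constSection]
    rw [t.symmL_continuousLinearMapAt (R := ℝ) hxb, t.symmL_continuousLinearMapAt (R := ℝ) hxb]
  rw [key]
  calc _ ≤ C₁ * ‖φ x (t.continuousLinearMapAt ℝ x v)‖ := hx₁ _
    _ ≤ C₁ * ((‖φ p‖ + 1) * ‖t.continuousLinearMapAt ℝ x v‖) := by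
        gcongr; exact ContinuousLinearMap.le_of_opNorm_le _ hx₃.le _
    _ ≤ C₁ * ((‖φ p‖ + 1) * (C₂ * vnorm h.toRiemannianMetric x v)) := by
        gcongr; exact hx₂ v
    _ = _ := by ring

/-- The Christoffel symbols of a smooth connection are locally bounded. -/
lemma eventually_vnorm_cov_constSection_le (hcov : cov.ContMDiffCovariantDerivative ∞) (p : M) :
    ∃ C > 0, ∀ᶠ x in 𝓝 p, ∀ (e : E) (v : TangentSpace I x),
      vnorm h.toRiemannianMetric x (cov (constSection p e) x v)
        ≤ C * ‖e‖ * vnorm h.toRiemannianMetric x v := by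
  let b := Module.finBasis ℝ E
  choose C hC hev using fun i ↦ eventually_vnorm_cov_constSection_le_of_vector h cov hcov p (b i)
  let c : Fin (Module.finrank ℝ E) → E →L[ℝ] ℝ := fun i ↦ (b.coord i).toContinuousLinearMap
  -- The `+ 1` only secures positivity, the sum being empty when `E` is zero.
  refine ⟨∑ i, ‖c i‖ * C i + 1, by
    have := Finset.sum_nonneg fun i (_ : i ∈ Finset.univ) ↦
      mul_nonneg (norm_nonneg (c i)) (hC i).le
    linarith, ?_⟩
  filter_upwards [Filter.eventually_all.2 hev,
    (isOpen_baseSetAt I p).mem_nhds (mem_baseSetAt I p)] with x hx hxb e v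
  rw [cov_constSection_eq_sum cov b hxb e, _root_.sum_apply]
  refine (vnorm_sum_le _ _ _ _).trans ?_
  have h0 := vnorm_nonneg h.toRiemannianMetric x v
  calc _ ≤ ∑ i, ‖c i‖ * C i * ‖e‖ * vnorm h.toRiemannianMetric x v := by
        refine Finset.sum_le_sum fun i _ ↦ ?_
        rw [_root_.smul_apply, vnorm_smul]
        have h1 : |b.repr e i| ≤ ‖c i‖ * ‖e‖ := (c i).le_opNorm e
        calc _ ≤ (‖c i‖ * ‖e‖) * (C i * vnorm h.toRiemannianMetric x v) :=
              mul_le_mul h1 (hx i v) (vnorm_nonneg _ _ _) (by positivity)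
          _ = _ := by ring
    _ = (∑ i, ‖c i‖ * C i) * ‖e‖ * vnorm h.toRiemannianMetric x v := by
        rw [Finset.sum_mul, Finset.sum_mul]
    _ ≤ _ := by gcongr; linarith

/-- The fibre coordinates grow at most exponentially with the Dombrowski length. -/
lemma eventually_norm_mvfderiv_fibreCoord_le (hcov : cov.ContMDiffCovariantDerivative ∞) (p : M) :
    ∃ C > 0, ∀ᶠ x in 𝓝 p, ∀ u : TangentBundle I M, u.proj = x → ∀ A : TangentSpace I.tangent u,
      ‖mvfderiv I.tangent (fibreCoord (I := I) p) u A‖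
        ≤ C * (1 + ‖fibreCoord p u‖) * vnorm (dombrowskiMetric h cov) u A := by
  obtain ⟨C₁, hC₁, h₁⟩ := eventually_norm_continuousLinearMapAt_le h p
  obtain ⟨C₂, hC₂, h₂⟩ := eventually_vnorm_cov_constSection_le h cov hcov p
  refine ⟨C₁ * (1 + C₂), by positivity, ?_⟩
  filter_upwards [h₁, h₂, (isOpen_baseSetAt I p).mem_nhds (mem_baseSetAt I p)]
    with x hx₁ hx₂ hxb u hu A
  subst hu
  have hK := connector_eq cov hxb A
  set d := mvfderiv I.tangent (fibreCoord (I := I) p) u A with hd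
  -- Solve for `d`: it represents `K A - Γ(b, π_* A)`, and the linearity of `Γ` in `b` produces the
  -- factor `1 + ‖b‖`.
  have hK' := eq_sub_of_add_eq hK.symm
  have hd' := (trivializationAt E (TangentSpace I : M → Type _) p).continuousLinearMapAt_symmL
    (R := ℝ) hxb d
  have h3 := hx₁ (constSection p d u.proj)
  rw [constSection, hd'] at h3
  change ‖d‖ ≤ C₁ * vnorm _ _ (constSection p d u.proj) at h3
  rw [hK'] at h3
  have h4 := vnorm_sub_le h.toRiemannianMetric u.proj (connector cov u A)
    (cov (constSection p (fibreCoord p u)) u.proj (projDeriv u A))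
  have h5 := hx₂ (fibreCoord p u) (projDeriv u A)
  have h6 := vnorm_projDeriv_le h cov u A
  have h7 := vnorm_connector_le h cov u A
  have h8 := vnorm_nonneg (dombrowskiMetric h cov) u A
  have h9 := norm_nonneg (fibreCoord (I := I) p u)
  have h10 : C₂ * ‖fibreCoord p u‖ * vnorm h.toRiemannianMetric u.proj (projDeriv u A)
      ≤ C₂ * ‖fibreCoord p u‖ * vnorm (dombrowskiMetric h cov) u A := by gcongr
  calc ‖d‖ ≤ C₁ * (vnorm (dombrowskiMetric h cov) u A
        + C₂ * ‖fibreCoord p u‖ * vnorm (dombrowskiMetric h cov) u A) :=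
        h3.trans (mul_le_mul_of_nonneg_left (by linarith) hC₁.le)
    _ = C₁ * (1 + C₂ * ‖fibreCoord p u‖) * vnorm (dombrowskiMetric h cov) u A := by ring
    _ ≤ C₁ * ((1 + C₂) * (1 + ‖fibreCoord p u‖)) * vnorm (dombrowskiMetric h cov) u A := by
        gcongr; nlinarith
    _ = _ := by ring

/-- The logarithm of the fibre norm is Lipschitz over a neighbourhood of `p`. -/
lemma eventually_abs_mvfderiv_logGrowth_le (hcov : cov.ContMDiffCovariantDerivative ∞) (p : M) :
    ∃ C > 0, ∀ᶠ x in 𝓝 p, ∀ u : TangentBundle I M, u.proj = x → ∀ A : TangentSpace I.tangent u,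
      |mvfderiv I.tangent (fun w ↦ logGrowth E (fibreCoord (I := I) p w)) u A|
        ≤ C * vnorm (dombrowskiMetric h cov) u A := by
  obtain ⟨C, hC, hev⟩ := eventually_norm_mvfderiv_fibreCoord_le h cov hcov p
  obtain ⟨D, hD, hfd⟩ := exists_fderiv_logGrowth_le (E := E)
  refine ⟨D * C + 1, by positivity, ?_⟩
  filter_upwards [hev, (isOpen_baseSetAt I p).mem_nhds (mem_baseSetAt I p)] with x hx hxb u hu A
  have hxA := hx u hu A
  subst hu
  have hA := vnorm_nonneg (dombrowskiMetric h cov) u A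
  have hcomp : mvfderiv I.tangent (fun w ↦ logGrowth E (fibreCoord (I := I) p w)) u A
      = fderiv ℝ (logGrowth E) (fibreCoord p u)
        (mvfderiv I.tangent (fibreCoord (I := I) p) u A) := by
    have h1 := mfderiv_comp u (I := I.tangent) (I' := 𝓘(ℝ, E)) (I'' := 𝓘(ℝ, ℝ))
      (f := fibreCoord (I := I) p) (g := logGrowth E)
      ((contDiff_logGrowth.differentiable (by simp)).mdifferentiable _)
      ((contMDiffAt_fibreCoord hxb).mdifferentiableAt (by simp))
    rw [mfderiv_eq_fderiv] at h1
    exact congr($h1 A)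
  rw [hcomp]
  have h2 := hfd (fibreCoord p u) (mvfderiv I.tangent (fibreCoord (I := I) p) u A)
  have hpos : 0 < 1 + ‖fibreCoord (I := I) p u‖ := by positivity
  -- After multiplication by `1 + ‖b‖`, the decay of the logarithm's derivative cancels the growth
  -- of the fibre coordinates.
  refine le_of_mul_le_mul_right ?_ hpos
  calc _ ≤ D * ‖mvfderiv I.tangent (fibreCoord (I := I) p) u A‖ := h2
    _ ≤ D * (C * (1 + ‖fibreCoord p u‖) * vnorm (dombrowskiMetric h cov) u A) := by gcongr
    _ = D * C * vnorm (dombrowskiMetric h cov) u A * (1 + ‖fibreCoord p u‖) := by ring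
    _ ≤ _ := by gcongr; linarith

end Estimates

/-! ### Distances on the tangent bundle and completeness -/

section Completeness

variable {E : Type*} [NormedAddCommGroup E] [NormedSpace ℝ E] [FiniteDimensional ℝ E]
  {H : Type*} [TopologicalSpace H] {I : ModelWithCorners ℝ E H}
  {M : Type*} [TopologicalSpace M] [ChartedSpace H M] [IsManifold I ∞ M]
  (h : ContMDiffRiemannianMetric I ∞ E (fun x : M ↦ TangentSpace I x))
  (cov : CovariantDerivative I E (TangentSpace I : M → Type _))

lemma rdist_proj_le (u v : TangentBundle I M) :
    rdist h.toRiemannianMetric u.proj v.proj ≤ rdist (dombrowskiMetric h cov) u v :=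
  rdist_map_le (dombrowskiMetric h cov) h.toRiemannianMetric
    (f := (TotalSpace.proj : TangentBundle I M → M))
    (contMDiff_proj (TangentSpace I : M → Type _)) (vnorm_projDeriv_le h cov) u v

/-- The horizontal component of `Y_* v` is `v` and its vertical component is `∇_v Y`. -/
lemma vnorm_mfderiv_section_le (Y : Π x : M, TangentSpace I x) (x : M)
    (hY : MDifferentiableAt I I.tangent (fun x ↦ (⟨x, Y x⟩ : TangentBundle I M)) x)
    (v : TangentSpace I x) :
    vnorm (dombrowskiMetric h cov) (⟨x, Y x⟩ : TangentBundle I M)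
        (mfderiv I I.tangent (fun x ↦ (⟨x, Y x⟩ : TangentBundle I M)) x v)
      ≤ vnorm h.toRiemannianMetric x v + vnorm h.toRiemannianMetric x (cov Y x v) := by
  have h1 := vnorm_dombrowskiMetric_le h cov (⟨x, Y x⟩ : TangentBundle I M)
    (mfderiv I I.tangent (fun x ↦ (⟨x, Y x⟩ : TangentBundle I M)) x v)
  rwa [projDeriv_mfderiv Y x hY, connector_mfderiv cov Y x hY] at h1

lemma rdist_zeroSection_le (x y : M) :
    rdist (dombrowskiMetric h cov) (⟨x, 0⟩ : TangentBundle I M) ⟨y, 0⟩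
      ≤ rdist h.toRiemannianMetric x y := by
  have hs : ContMDiff I I.tangent ∞ (fun x ↦ (⟨x, (0 : Π x : M, TangentSpace I x) x⟩ :
      TangentBundle I M)) := contMDiff_zeroSection ℝ (TangentSpace I : M → Type _)
  refine rdist_map_le h.toRiemannianMetric (dombrowskiMetric h cov)
    (hs.of_le (by simp)) (fun x v ↦ ?_) x y
  refine (vnorm_mfderiv_section_le h cov 0 x (hs.mdifferentiable (by simp) x) v).trans ?_
  rw [cov.zero]
  exact (add_le_add_right (vnorm_zero _ _).le _).trans (add_zero _).le

/-- The straight segment in the fibre has vertical velocity, which the connector sends to `w - v` at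
every time. -/
lemma rdist_fibre_le (p : M) (v w : TangentSpace I p) :
    rdist (dombrowskiMetric h cov) (⟨p, v⟩ : TangentBundle I M) ⟨p, w⟩
      ≤ ENNReal.ofReal (vnorm h.toRiemannianMetric p (w - v)) := by
  have hp := mem_baseSetAt I p
  set τ := (trivializationAt E (TangentSpace I : M → Type _) p).continuousLinearMapAt ℝ p with hτ
  let γ : ℝ → TangentBundle I M := fun t ↦ ⟨p, v + t • (w - v)⟩
  have hfc : fibreCoord (I := I) p ∘ γ = fun t ↦ τ v + t • τ (w - v) := by
    funext t
    have : fibreCoord (I := I) p (γ t) = τ (v + t • (w - v)) := by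
      rw [hτ, Trivialization.continuousLinearMapAt_apply,
        Trivialization.coe_linearMapAt_of_mem _ hp]
      rfl
    simpa using this
  have hd : ∀ t, HasDerivAt (fun t : ℝ ↦ τ v + t • τ (w - v)) (τ (w - v)) t := fun t ↦ by
    simpa using ((hasDerivAt_id t).smul_const (τ (w - v))).const_add (τ v)
  have hγ : ContMDiff 𝓘(ℝ, ℝ) I.tangent 1 γ := fun t ↦ by
    refine ((trivializationAt E (TangentSpace I : M → Type _) p).contMDiffAt_iff
      (f := γ) ((Trivialization.mem_source _).2 hp)).2 ⟨contMDiffAt_const, ?_⟩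
    change ContMDiffAt 𝓘(ℝ, ℝ) 𝓘(ℝ, E) 1 (fibreCoord (I := I) p ∘ γ) t
    rw [hfc]
    exact ContDiffAt.contMDiffAt (by fun_prop)
  have hspeed : ∀ t, vnorm (dombrowskiMetric h cov) (γ t)
      (mfderiv 𝓘(ℝ, ℝ) I.tangent γ t (1 : ℝ)) ≤ vnorm h.toRiemannianMetric p (w - v) := by
    intro t
    have hγt := hγ.mdifferentiable one_ne_zero t
    have hπ : projDeriv (γ t) (mfderiv 𝓘(ℝ, ℝ) I.tangent γ t (1 : ℝ)) = 0 := by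
      have h1 := mfderiv_comp t (mdifferentiableAt_tangentProj (γ t)) hγt
      have h2 : mfderiv 𝓘(ℝ, ℝ) I ((TotalSpace.proj : TangentBundle I M → M) ∘ γ) t = 0 :=
        mfderiv_const
      exact congr($h1 (1 : ℝ)).symm.trans congr($h2 (1 : ℝ))
    have hK := connector_of_vertical cov (p := p) (u := γ t) hp _ hπ
    have hv : mvfderiv I.tangent (fibreCoord (I := I) p) (γ t)
        (mfderiv 𝓘(ℝ, ℝ) I.tangent γ t (1 : ℝ)) = τ (w - v) := by
      have h1 := mfderiv_comp t (I'' := 𝓘(ℝ, E)) (mdifferentiableAt_fibreCoord (γ t)) hγt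
      change mfderiv 𝓘(ℝ, ℝ) 𝓘(ℝ, E) (fibreCoord (I := I) p ∘ γ) t = _ at h1
      rw [hfc, mfderiv_eq_fderiv, (hd t).hasFDerivAt.fderiv] at h1
      refine congr($h1 (1 : ℝ)).symm.trans ?_
      simp
    have hc : constSection p (τ (w - v)) p = w - v :=
      Trivialization.symmL_continuousLinearMapAt (R := ℝ) _ hp (w - v)
    rw [hv] at hK
    refine (vnorm_dombrowskiMetric_le h cov _ _).trans ?_
    rw [hπ, hK, vnorm_zero, zero_add]
    exact (congrArg (vnorm h.toRiemannianMetric p) hc).le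
  have h0 : γ 0 = ⟨p, v⟩ := by simp [γ]
  have h1 : γ 1 = ⟨p, w⟩ := by simp [γ]
  rw [← h0, ← h1]
  refine (rdist_le_setLIntegral (dombrowskiMetric h cov) zero_le_one hγ.contMDiffOn).trans ?_
  refine (setLIntegral_mono' measurableSet_Icc
    fun t _ ↦ ENNReal.ofReal_le_ofReal (hspeed t)).trans ?_
  simp

/-- Moving along a field with constant components over a small ball expands distances by a
controlled factor. -/
lemma rdist_constSection_le {p : M} {r : ℝ≥0∞} {C : ℝ} (hC : 0 ≤ C)
    (hr : ∀ x, rdist h.toRiemannianMetric p x < r → x ∈ baseSetAt I p ∧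
      ∀ (e : E) (v : TangentSpace I x), vnorm h.toRiemannianMetric x (cov (constSection p e) x v)
        ≤ C * ‖e‖ * vnorm h.toRiemannianMetric x v)
    (e : E) {q : M} (hq : rdist h.toRiemannianMetric p q < r) :
    rdist (dombrowskiMetric h cov) (⟨p, constSection p e p⟩ : TangentBundle I M)
        ⟨q, constSection p e q⟩
      ≤ ENNReal.ofReal (1 + C * ‖e‖) * rdist h.toRiemannianMetric p q := by
  -- A path of length below `L < r` starting at `p` cannot leave the ball where the field is
  -- controlled. Letting `L` decrease to the distance then gives the sharp factor.
  have hbound : ∀ L, rdist h.toRiemannianMetric p q < L → L < r →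
      rdist (dombrowskiMetric h cov) (⟨p, constSection p e p⟩ : TangentBundle I M)
        ⟨q, constSection p e q⟩ ≤ ENNReal.ofReal (1 + C * ‖e‖) * L := by
    intro L hL hLr
    obtain ⟨γ, h0, h1, hγ, hlen⟩ := exists_path_of_rdist_lt _ hL
    have hball : ∀ t ∈ Icc (0 : ℝ) 1, rdist h.toRiemannianMetric p (γ t) < r := fun t ht ↦ by
      rw [← h0]
      exact (rdist_le_pathLength _ hγ ht).trans_lt (hlen.trans hLr)
    have h2 := rdist_map_le_pathLength h.toRiemannianMetric (dombrowskiMetric h cov)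
      (f := fun x ↦ (⟨x, constSection p e x⟩ : TangentBundle I M)) (C := 1 + C * ‖e‖)
      (by positivity) hγ
      (fun t ht ↦ (contMDiffAt_constSection (hr _ (hball t ht)).1 e).of_le (by simp))
      (fun t ht v ↦ by
        have h3 := vnorm_mfderiv_section_le h cov (constSection p e) (γ t)
          (mdifferentiableAt_constSection (hr _ (hball t ht)).1 e) v
        have h4 := (hr _ (hball t ht)).2 e v
        refine h3.trans ?_
        linarith)
    rw [h0, h1] at h2
    exact h2.trans (by gcongr)
  have ht : Tendsto (fun L ↦ ENNReal.ofReal (1 + C * ‖e‖) * L)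
      (𝓝[>] (rdist h.toRiemannianMetric p q))
      (𝓝 (ENNReal.ofReal (1 + C * ‖e‖) * rdist h.toRiemannianMetric p q)) :=
    (ENNReal.Tendsto.const_mul tendsto_id (Or.inr ENNReal.ofReal_ne_top)).mono_left
      nhdsWithin_le_nhds
  have : (𝓝[>] (rdist h.toRiemannianMetric p q)).NeBot := nhdsGT_neBot_of_exists_gt ⟨r, hq⟩
  refine ge_of_tendsto ht ?_
  filter_upwards [Ioo_mem_nhdsGT hq] with L hL
  exact hbound L hL.1 hL.2

/-- Over a small ball, points at bounded Dombrowski distance have fibre norms of bounded ratio. -/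
lemma abs_logGrowth_sub_le {p : M} {r s : ℝ≥0∞} {C : ℝ} (hC : 0 ≤ C)
    (hr : ∀ x, rdist h.toRiemannianMetric p x < r → x ∈ baseSetAt I p ∧
      ∀ u : TangentBundle I M, u.proj = x → ∀ A : TangentSpace I.tangent u,
        |mvfderiv I.tangent (fun w ↦ logGrowth E (fibreCoord (I := I) p w)) u A|
          ≤ C * vnorm (dombrowskiMetric h cov) u A)
    {u v : TangentBundle I M} (hu : rdist h.toRiemannianMetric p u.proj + s ≤ r)
    (hs : s ≠ ⊤) (hfin : rdist h.toRiemannianMetric p u.proj ≠ ⊤)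
    (huv : rdist (dombrowskiMetric h cov) u v < s) :
    |logGrowth E (fibreCoord p v) - logGrowth E (fibreCoord p u)| ≤ C * s.toReal := by
  obtain ⟨γ, h0, h1, hγ, hlen⟩ := exists_path_of_rdist_lt _ huv
  -- The projection is nonexpanding, so the base path stays within `s` of its starting point and
  -- hence in the ball of radius `r`.
  have hball : ∀ t ∈ Icc (0 : ℝ) 1, rdist h.toRiemannianMetric p (γ t).proj < r := fun t ht ↦ by
    have h2 := (rdist_le_pathLength _ hγ ht).trans_lt hlen
    rw [h0] at h2
    calc _ ≤ rdist h.toRiemannianMetric p u.proj + rdist h.toRiemannianMetric u.proj (γ t).proj :=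
          rdist_triangle _ _ _ _
      _ ≤ rdist h.toRiemannianMetric p u.proj + rdist (dombrowskiMetric h cov) u (γ t) := by
          gcongr; exact rdist_proj_le h cov u (γ t)
      _ < rdist h.toRiemannianMetric p u.proj + s := ENNReal.add_lt_add_left hfin h2
      _ ≤ r := hu
  have h3 := ofReal_abs_sub_le_pathLength (dombrowskiMetric h cov)
    (φ := fun w ↦ logGrowth E (fibreCoord (I := I) p w)) hC hγ
    (fun t ht ↦ ((contDiff_logGrowth.contMDiff.contMDiffAt.comp (γ t)
      (contMDiffAt_fibreCoord (hr _ (hball t ht)).1))).of_le (by simp))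
    (fun t ht A ↦ (hr _ (hball t ht)).2 (γ t) rfl A)
  rw [h0, h1] at h3
  have h4 : ENNReal.ofReal |logGrowth E (fibreCoord p v) - logGrowth E (fibreCoord p u)|
      ≤ ENNReal.ofReal (C * s.toReal) := by
    rw [ENNReal.ofReal_mul hC, ENNReal.ofReal_toReal hs]
    exact h3.trans (by gcongr)
  exact (ENNReal.ofReal_le_ofReal_iff (by positivity)).1 h4

lemma isCompleteFor_of_dombrowskiMetric (hc : IsCompleteFor (dombrowskiMetric h cov)) :
    IsCompleteFor h.toRiemannianMetric := by
  rw [isCompleteFor_iff] at hc ⊢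
  intro u hu
  obtain ⟨x, hx⟩ := hc (fun n ↦ ⟨u n, 0⟩) fun ε hε ↦ by
    obtain ⟨N, hN⟩ := hu ε hε
    exact ⟨N, fun m hm n hn ↦ (rdist_zeroSection_le h cov _ _).trans_lt (hN m hm n hn)⟩
  exact ⟨x.proj, tendsto_of_tendsto_of_tendsto_of_le_of_le tendsto_const_nhds hx
    (fun _ ↦ zero_le) fun n ↦ rdist_proj_le h cov ⟨u n, 0⟩ x⟩

lemma isCompleteFor_dombrowskiMetric [T2Space M] [LocallyCompactSpace M]
    (hcov : cov.ContMDiffCovariantDerivative ∞)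
    (hc : IsCompleteFor h.toRiemannianMetric) : IsCompleteFor (dombrowskiMetric h cov) := by
  rw [isCompleteFor_iff] at hc ⊢
  intro u hu
  obtain ⟨p, hp⟩ := hc (fun n ↦ (u n).proj) fun ε hε ↦ by
    obtain ⟨N, hN⟩ := hu ε hε
    exact ⟨N, fun m hm n hn ↦ (rdist_proj_le h cov _ _).trans_lt (hN m hm n hn)⟩
  simp only [rdist_comm _ _ p] at hp
  obtain ⟨C₁, hC₁, h₁⟩ := eventually_vnorm_constSection_le h p
  obtain ⟨C₂, hC₂, h₂⟩ := eventually_vnorm_cov_constSection_le h cov hcov p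
  obtain ⟨C₃, hC₃, h₃⟩ := eventually_abs_mvfderiv_logGrowth_le h cov hcov p
  obtain ⟨K, hK, hKe⟩ := exists_norm_le_exp_logGrowth (E := E)
  -- Here the distance meets the manifold topology: one Riemannian ball at `p` lies in the
  -- neighbourhood where all local bounds hold.
  obtain ⟨r, hr, hball⟩ : ∃ c > (0 : NNReal), {y | rdist h.toRiemannianMetric p y < c} ⊆ _ := by
    let : RiemannianBundle (fun x : M ↦ TangentSpace I x) := ⟨h.toRiemannianMetric⟩
    have : IsContinuousRiemannianBundle E (fun x : M ↦ TangentSpace I x) :=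
      ⟨h.inner, h.contMDiff.continuous, fun _ _ _ ↦ rfl⟩
    exact setOfPred_riemannianEDist_lt_subset_nhds I
      (((isOpen_baseSetAt I p).eventually_mem (mem_baseSetAt I p)).and (h₂.and h₃))
  have hr2 : (0 : ℝ≥0∞) < r / 2 := ENNReal.half_pos (by simpa using hr.ne')
  have hr2' : (r / 2 : ℝ≥0∞) < r := ENNReal.half_lt_self (by simpa using hr.ne') (by simp)
  obtain ⟨N₁, hN₁⟩ := hu (r / 2) hr2
  obtain ⟨N₂, hN₂⟩ := eventually_atTop.1 (hp.eventually_lt_const hr2)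
  set N := max N₁ N₂ with hN
  -- From `N` on, base points are within `r / 2` of `p` and terms within `r / 2` of `u N`, so the
  -- joining paths stay over the ball and the Lipschitz bound gives `B`.
  set B := logGrowth E (fibreCoord p (u N)) + C₃ * (r / 2 : ℝ≥0∞).toReal with hB
  have hpn : ∀ n ≥ N, rdist h.toRiemannianMetric p (u n).proj < r := fun n hn ↦
    (hN₂ n ((le_max_right _ _).trans hn)).trans hr2'
  have hy : ∀ n ≥ N, ‖fibreCoord p (u n)‖ ≤ K * Real.exp B := by
    intro n hn
    have h4 := abs_logGrowth_sub_le h cov hC₃.le (fun x hx ↦ ⟨(hball hx).1, (hball hx).2.2⟩)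
      (u := u N) (v := u n) (s := r / 2)
      ((add_le_add (hN₂ N (le_max_right _ _)).le le_rfl).trans (ENNReal.add_halves _).le)
      hr2'.ne_top (hpn N le_rfl).ne_top
      (hN₁ N (le_max_left _ _) n ((le_max_left _ _).trans hn))
    refine (hKe _).trans ?_
    gcongr
    have := (abs_le.1 h4).2
    linarith
  obtain ⟨y, -, k, hk, hky⟩ := (isCompact_closedBall (0 : E) (K * Real.exp B)).tendsto_subseq
    (x := fun n ↦ fibreCoord p (u (N + n))) fun n ↦ by simpa using hy (N + n) (by omega)
  have hNk : Tendsto (fun n ↦ N + k n) atTop atTop :=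
    tendsto_atTop_mono (fun n ↦ (hk.id_le n).trans (Nat.le_add_left _ _)) tendsto_id
  refine ⟨⟨p, constSection p y p⟩, tendsto_rdist_of_subseq _ hu hNk ?_⟩
  -- The first summand moves to the fibre over `p` with frozen coordinates, at a factor uniform in
  -- `n` because these are bounded; the second corrects the coordinates inside that fibre.
  have hle : ∀ n, rdist (dombrowskiMetric h cov) (u (N + k n))
      (⟨p, constSection p y p⟩ : TangentBundle I M)
      ≤ ENNReal.ofReal (1 + C₂ * (K * Real.exp B))
          * rdist h.toRiemannianMetric p (u (N + k n)).proj
        + ENNReal.ofReal (C₁ * ‖y - fibreCoord p (u (N + k n))‖) := by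
    intro n
    set w := u (N + k n)
    have hw := hpn (N + k n) (by omega)
    have h5 := rdist_constSection_le h cov hC₂.le
      (fun x hx ↦ ⟨(hball hx).1, (hball hx).2.1⟩) (fibreCoord p w) hw
    rw [constSection_fibreCoord (hball hw).1, rdist_comm] at h5
    have h6 := rdist_fibre_le h cov p (constSection p (fibreCoord p w) p) (constSection p y p)
    have h7 : constSection (I := I) p y p - constSection p (fibreCoord p w) p
        = constSection p (y - fibreCoord p w) p := (map_sub _ _ _).symm
    rw [h7] at h6
    refine (rdist_triangle _ _ _ _).trans (add_le_add (h5.trans ?_) (h6.trans ?_))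
    · gcongr
      exact hy _ (by omega)
    · exact ENNReal.ofReal_le_ofReal (h₁.self_of_nhds _)
  refine tendsto_of_tendsto_of_tendsto_of_le_of_le tendsto_const_nhds ?_ (fun _ ↦ zero_le) hle
  rw [← add_zero (0 : ℝ≥0∞)]
  refine Tendsto.add ?_ ?_
  · have := ENNReal.Tendsto.const_mul (a := ENNReal.ofReal (1 + C₂ * (K * Real.exp B)))
      (hp.comp hNk) (Or.inr ENNReal.ofReal_ne_top)
    simpa using this
  · have h8 : Tendsto (fun n ↦ C₁ * ‖y - fibreCoord p (u (N + k n))‖) atTop (𝓝 0) := by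
      simpa using ((tendsto_const_nhds (x := y)).sub hky).norm.const_mul C₁
    simpa using ENNReal.tendsto_ofReal h8

end Completeness

end DuallyFlat

end

theorem proposition2p15
    {E : Type*} [NormedAddCommGroup E] [NormedSpace ℝ E] [FiniteDimensional ℝ E]
    {M : Type*} [TopologicalSpace M] [T2Space M] [ChartedSpace E M] [IsManifold 𝓘(ℝ, E) ∞ M]
    (h : Bundle.ContMDiffRiemannianMetric 𝓘(ℝ, E) ∞ E (fun x : M ↦ TangentSpace 𝓘(ℝ, E) x))
    (cov covStar : CovariantDerivative 𝓘(ℝ, E) E (TangentSpace 𝓘(ℝ, E) : M → Type _))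
    (hflat : DuallyFlat.IsDuallyFlat h cov covStar) :
    DuallyFlat.IsCompleteFor (DuallyFlat.dombrowskiMetric h cov) ↔
      DuallyFlat.IsCompleteFor h.toRiemannianMetric := by
  have : LocallyCompactSpace M := Manifold.locallyCompact_of_finiteDimensional 𝓘(ℝ, E)
  exact ⟨DuallyFlat.isCompleteFor_of_dombrowskiMetric h cov,
    DuallyFlat.isCompleteFor_dombrowskiMetric h cov hflat.dualistic.smooth⟩
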